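/- **Theorem 1 (zero duality gap).** Let $\mathcal X\subset\mathbb R^p$ and $\mathcal W\subset\mathbb R$ be compact, let $x_1,\dots,x_N\in\mathcal X$, $y_1,\dots,y_N\in\mathbb R$ and $\gamma\ge 0$. Let $c:\mathbb R\times\mathbb R\to\mathbb R$ be a loss such that $c(\cdot,y_i)$ is convex for every $i$. Let $k(x,z;w)$ be a real-valued kernel without point masses, that is, each section $(z,w)\mapsto k(x_i,z;w)$ is a genuine Lebesgue-measurable function on $\mathcal X\times\mathcal W$ (not a distribution containing Dirac deltas), integrated against Lebesgue measure. Let $\mathcal A$ be the set of all $\alpha\in L_2(\mathcal X\times\mathcal W)$ for which the integrals $$f_\alpha(x_i)=\int_{\mathcal X\times\mathcal W}\alpha(z,w)\,k(x_i,z;w)\,dz\,dw,\qquad i=1,\dots,N,$$ exist (so $\mathcal A=L_2(\mathcal X\times\mathcal W)$ if the sections $k(x_i,\cdot;\cdot)$ are square integrable). Write $\|\alpha\|_{L_0}$ for the Lebesgue measure of $\{(z,w)\in\mathcal X\times\mathcal W:\alpha(z,w)\ne 0\}$. Consider the sparse functional program $$P=\inf_{\alpha\in\mathcal A,\ \hat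 y\in\mathbb R^N}\ \tfrac12\|\alpha\|_{L_2}^2+\gamma\|\alpha\|_{L_0}\quad\text{subject to}\quad c(\hat y_i,y_i)\le 0,\quad \hat y_i=f_\alpha(x_i),\quad i=1,\dots,N,$$ its Lagrangian $$\mathcal L(\alpha,\hat y,\lambda,\mu)=\tfrac12\|\alpha\|_{L_2}^2+\gamma\|\alpha\|_{L_0}-\sum_{i=1}^N\lambda_i f_\alpha(x_i)+\sum_{i=1}^N\lambda_i\hat y_i+\sum_{i=1}^N\mu_i\,c(\hat y_i,y_i),$$ and the dual problem $$D=\sup_{\lambda\in\mathbb R^N,\ \mu\in\mathbb R^N_+}\ \inf_{\alpha\in\mathcal A,\ \hat y\in\mathbb R^N}\mathcal L(\alpha,\hat y,\lambda,\mu).$$ Assume Slater's condition: there is $\alpha\in\mathcal A$ with $c(f_\alpha(x_i),y_i)<0$ for all $i=1,\dots,N$. Then $P$ and $D$ are finite and the duality gap vanishes: $P-D=0$. -/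

import Mathlib

open MeasureTheory

noncomputable section

namespace SFP

/-- Centers `z ∈ ℝ^p` paired with kernel parameters `w ∈ ℝ`. -/
abbrev Pt (p : ℕ) : Type := EuclideanSpace ℝ (Fin p) × ℝ

/-- Lebesgue measure `dz dw` restricted to `X × W`. -/
abbrev leb {p : ℕ} (X : Set (EuclideanSpace ℝ (Fin p))) (W : Set ℝ) : Measure (Pt p) :=
  (volume : Measure (Pt p)).restrict (X ×ˢ W)

/-- The coefficient space `L²(X × W)`. -/
abbrev Coef {p : ℕ} (X : Set (EuclideanSpace ℝ (Fin p))) (W : Set ℝ) : Type :=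
  Lp ℝ 2 (leb X W)

variable {p N : ℕ} {X : Set (EuclideanSpace ℝ (Fin p))} {W : Set ℝ}

/-- The "`L⁰`-norm": the measure of the set where `α ≠ 0`. -/
def l0 (α : Coef X W) : ℝ := (leb X W).real {v | α v ≠ 0}

/-- The objective `½ ‖α‖²_{L²} + γ ‖α‖_{L⁰}`. -/
def objective (γ : ℝ) (α : Coef X W) : ℝ := 1 / 2 * ‖α‖ ^ 2 + γ * l0 α

/-- All the integrals `∫ α(z,w) k(x_i, z; w) dz dw` exist (as Lebesgue integrals). This holds
for every `α ∈ L²` as soon as the sections `k(x_i, ·; ·)` are square integrable, see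
`admissible_of_memLp`. -/
def Admissible (k : EuclideanSpace ℝ (Fin p) → EuclideanSpace ℝ (Fin p) → ℝ → ℝ)
    (x : Fin N → EuclideanSpace ℝ (Fin p)) (α : Coef X W) : Prop :=
  ∀ i, Integrable (fun v : Pt p => α v * k (x i) v.1 v.2) (leb X W)

/-- The prediction `f(x) = ∫ α(z,w) k(x, z; w) dz dw`. -/
def predict (k : EuclideanSpace ℝ (Fin p) → EuclideanSpace ℝ (Fin p) → ℝ → ℝ)
    (α : Coef X W) (x : EuclideanSpace ℝ (Fin p)) : ℝ :=
  ∫ v : Pt p, α v * k x v.1 v.2 ∂(leb X W)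

/-- Feasibility of `(α, ŷ)`: `ŷ_i = f(x_i)` and `c(ŷ_i, y_i) ≤ 0`. -/
def Feasible (k : EuclideanSpace ℝ (Fin p) → EuclideanSpace ℝ (Fin p) → ℝ → ℝ)
    (c : ℝ → ℝ → ℝ) (x : Fin N → EuclideanSpace ℝ (Fin p)) (y : Fin N → ℝ)
    (α : Coef X W) (yhat : Fin N → ℝ) : Prop :=
  Admissible k x α ∧ (∀ i, yhat i = predict k α (x i)) ∧ ∀ i, c (yhat i) (y i) ≤ 0

/-- Slater's condition: some `(α, ŷ)` meets the linear equality constraints, and the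
inequality constraints strictly. -/
def Slater (X : Set (EuclideanSpace ℝ (Fin p))) (W : Set ℝ)
    (k : EuclideanSpace ℝ (Fin p) → EuclideanSpace ℝ (Fin p) → ℝ → ℝ)
    (c : ℝ → ℝ → ℝ) (x : Fin N → EuclideanSpace ℝ (Fin p)) (y : Fin N → ℝ) : Prop :=
  ∃ (α : Coef X W) (yhat : Fin N → ℝ),
    Admissible k x α ∧ (∀ i, yhat i = predict k α (x i)) ∧ ∀ i, c (yhat i) (y i) < 0

/-- The optimal value of the primal problem (an infimum in `[-∞, ∞]`). -/
def primalValue (X : Set (EuclideanSpace ℝ (Fin p))) (W : Set ℝ)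
    (k : EuclideanSpace ℝ (Fin p) → EuclideanSpace ℝ (Fin p) → ℝ → ℝ)
    (c : ℝ → ℝ → ℝ) (x : Fin N → EuclideanSpace ℝ (Fin p)) (y : Fin N → ℝ) (γ : ℝ) : EReal :=
  ⨅ (α : Coef X W) (yhat : Fin N → ℝ) (_ : Feasible k c x y α yhat), (objective γ α : EReal)

/-- The Lagrangian, with multipliers `lam` for `ŷ_i = f(x_i)` and `mu` for
`c(ŷ_i, y_i) ≤ 0`. -/
def lagrangian (k : EuclideanSpace ℝ (Fin p) → EuclideanSpace ℝ (Fin p) → ℝ → ℝ)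
    (c : ℝ → ℝ → ℝ) (x : Fin N → EuclideanSpace ℝ (Fin p)) (y : Fin N → ℝ) (γ : ℝ)
    (α : Coef X W) (yhat lam mu : Fin N → ℝ) : ℝ :=
  objective γ α - ∑ i, lam i * predict k α (x i) + ∑ i, lam i * yhat i
    + ∑ i, mu i * c (yhat i) (y i)

/-- The dual function: the infimum of the Lagrangian over `α` and `ŷ ∈ ℝ^N`. -/
def dualFunction (X : Set (EuclideanSpace ℝ (Fin p))) (W : Set ℝ)
    (k : EuclideanSpace ℝ (Fin p) → EuclideanSpace ℝ (Fin p) → ℝ → ℝ)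
    (c : ℝ → ℝ → ℝ) (x : Fin N → EuclideanSpace ℝ (Fin p)) (y : Fin N → ℝ) (γ : ℝ)
    (lam mu : Fin N → ℝ) : EReal :=
  ⨅ (α : Coef X W) (_ : Admissible k x α) (yhat : Fin N → ℝ),
    (lagrangian k c x y γ α yhat lam mu : EReal)

/-- The optimal value of the dual problem: the supremum of the dual function over `lam ∈ ℝ^N`
and `mu ∈ ℝ^N_+`. -/
def dualValue (X : Set (EuclideanSpace ℝ (Fin p))) (W : Set ℝ)
    (k : EuclideanSpace ℝ (Fin p) → EuclideanSpace ℝ (Fin p) → ℝ → ℝ)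
    (c : ℝ → ℝ → ℝ) (x : Fin N → EuclideanSpace ℝ (Fin p)) (y : Fin N → ℝ) (γ : ℝ) : EReal :=
  ⨆ (lam : Fin N → ℝ) (mu : Fin N → ℝ) (_ : ∀ i, 0 ≤ mu i), dualFunction X W k c x y γ lam mu

/-- For square integrable kernel sections, every `α ∈ L²(X × W)` is admissible. -/
theorem admissible_of_memLp
    (k : EuclideanSpace ℝ (Fin p) → EuclideanSpace ℝ (Fin p) → ℝ → ℝ)
    (x : Fin N → EuclideanSpace ℝ (Fin p))
    (hk : ∀ i, MemLp (fun v : Pt p => k (x i) v.1 v.2) 2 (leb X W)) (α : Coef X W) :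
    Admissible k x α :=
  fun i => (Lp.memLp α).integrable_mul (hk i)

end SFP

end

/-!
The objective is not convex, but the problem depends on `α` only through the pair of its predictions
and its objective value, and this pair is an integral over `X × W` of a function of `α(z, w)`.
Using `α` on a measurable set and `β` off it splits such integrals, and since Lebesgue measure has
no atoms every convex combination of two of them is a limit of integrals so obtained: this is the
approximate form of Lyapunov's convexity theorem. Hence the set of attainable pairs has convex
closure.

Perturbing the constraints to `ŷ = f_α(x) + u` and `c(ŷ_i, y_i) < q_i` and asking for an objective
below `t` gives an open set of triples `(u, q, t)`, which depends on the attainable set only through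
its closure and is therefore convex. It misses `(0, 0, P)`, and by Slater's condition it meets the
vertical line through `(0, 0, P)`, so a hyperplane separating the two is not vertical: its slope
consists of the optimal multipliers.
-/

namespace SFP

open Filter Set Topology

section ConvexDuality

variable {E ι : Type*}

theorem linearMap_pi_apply_eq_sum {R : Type*} [CommSemiring R] [Fintype ι] [DecidableEq ι]
    (f : (ι → R) →ₗ[R] R) (v : ι → R) : f v = ∑ i, f (Pi.single i 1) * v i := by
  conv_lhs => rw [pi_eq_sum_univ' v, map_sum]
  simp only [map_smul, smul_eq_mul, mul_comm]

variable [AddCommGroup E]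

/-- The perturbations `(u, q, t)` of a program that are strictly feasible: some `s = (v, o) ∈ S`,
an argument `v` with its cost `o`, satisfies `φ i (v + u) < q i` for all `i` and `o < t`. Its fibre
over `(u, q)` is the open ray above the optimal value of the program perturbed by `(u, q)`. -/
def perturbations (S : Set (E × ℝ)) (φ : ι → E → ℝ) : Set ((E × (ι → ℝ)) × ℝ) :=
  {p | ∃ s ∈ S, (∀ i, φ i (s.1 + p.1.1) < p.1.2 i) ∧ s.2 < p.2}

variable {S : Set (E × ℝ)} {φ : ι → E → ℝ}

theorem convex_perturbations [Module ℝ E] (hS : Convex ℝ S) (hφ : ∀ i, ConvexOn ℝ univ (φ i)) :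
    Convex ℝ (perturbations S φ) := by
  rw [convex_iff_forall_pos]
  rintro p ⟨s, hs, hsφ, hsp⟩ p' ⟨s', hs', hs'φ, hs'p⟩ a b ha hb hab
  refine ⟨a • s + b • s', hS hs hs' ha.le hb.le hab, fun i => ?_, ?_⟩
  · calc φ i ((a • s + b • s').1 + (a • p + b • p').1.1)
        = φ i (a • (s.1 + p.1.1) + b • (s'.1 + p'.1.1)) := by
          congr 1
          simp only [Prod.fst_add, Prod.smul_fst]
          module
      _ ≤ a • φ i (s.1 + p.1.1) + b • φ i (s'.1 + p'.1.1) :=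
          (hφ i).2 (mem_univ _) (mem_univ _) ha.le hb.le hab
      _ < a • p.1.2 i + b • p'.1.2 i :=
          add_lt_add (smul_lt_smul_of_pos_left (hsφ i) ha) (smul_lt_smul_of_pos_left (hs'φ i) hb)
  · exact add_lt_add (smul_lt_smul_of_pos_left hsp ha) (smul_lt_smul_of_pos_left hs'p hb)

variable [TopologicalSpace E]

theorem isOpen_perturbations [ContinuousAdd E] [Finite ι] (hφ : ∀ i, Continuous (φ i)) :
    IsOpen (perturbations S φ) := by
  have hunion : perturbations S φ =
      ⋃ s ∈ S, (⋂ i, {p | φ i (s.1 + p.1.1) < p.1.2 i}) ∩ {p | s.2 < p.2} := by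
    ext p
    simp only [perturbations, mem_ofPred_eq, mem_iUnion, mem_inter_iff, mem_iInter, exists_prop]
  rw [hunion]
  refine isOpen_biUnion fun s _ => (isOpen_iInter_of_finite fun i => ?_).inter ?_
  · exact isOpen_lt (by have := hφ i; fun_prop) (by fun_prop)
  · exact isOpen_lt continuous_const continuous_snd

theorem perturbations_closure [ContinuousAdd E] [Finite ι] (hφ : ∀ i, Continuous (φ i)) :
    perturbations (closure S) φ = perturbations S φ := by
  refine Subset.antisymm ?_ fun p ⟨s, hs, h⟩ => ⟨s, subset_closure hs, h⟩
  rintro p ⟨s, hs, hsφ, hsp⟩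
  have hopen : IsOpen ((⋂ i, {s : E × ℝ | φ i (s.1 + p.1.1) < p.1.2 i}) ∩ {s | s.2 < p.2}) := by
    refine (isOpen_iInter_of_finite fun i => ?_).inter (isOpen_lt continuous_snd continuous_const)
    exact isOpen_lt (by have := hφ i; fun_prop) continuous_const
  obtain ⟨s', ⟨hs'φ, hs'p⟩, hs'⟩ := mem_closure_iff.1 hs _ hopen ⟨mem_iInter.2 hsφ, hsp⟩
  exact ⟨s', hs', mem_iInter.1 hs'φ, hs'p⟩

variable [Module ℝ E]

theorem convex_closure_of_add_smul_mem_closure [ContinuousAdd E] [ContinuousConstSMul ℝ E]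
    {S : Set E} (hS : ∀ s ∈ S, ∀ t ∈ S, ∀ a b : ℝ,
      0 ≤ a → 0 ≤ b → a + b = 1 → a • s + b • t ∈ closure S) :
    Convex ℝ (closure S) := by
  intro s hs t ht a b ha hb hab
  have hmem := map_mem_closure₂ (f := fun s t : E => a • s + b • t) (by fun_prop) hs ht
    fun s hs t ht => hS s hs t ht a b ha hb hab
  rwa [closure_closure] at hmem

theorem exists_strongDual_add_lt [IsTopologicalAddGroup E] [ContinuousSMul ℝ E] {C : Set (E × ℝ)}
    (hC : Convex ℝ C) (hCo : IsOpen C) {P t : ℝ} (hP : (0, P) ∉ C) (ht : (0, t) ∈ C) (hPt : P < t) :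
    ∃ l : StrongDual ℝ E, ∀ q ∈ C, P + l q.1 < q.2 := by
  obtain ⟨f, hf⟩ := geometric_hahn_banach_point_open hC hCo hP
  set r := f (0, 1) with hr
  have hf_apply (u : E) (τ : ℝ) : f (u, τ) = f (u, 0) + τ * r := by
    rw [hr, ← smul_eq_mul, ← map_smul, ← map_add]
    simp
  have hr_pos : 0 < r := by
    have hlt := hf _ ht
    rw [hf_apply, hf_apply 0 t, add_lt_add_iff_left] at hlt
    nlinarith
  refine ⟨-(r⁻¹ • f.comp (.inl ℝ E ℝ)), fun q hq => ?_⟩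
  have hlt : P * r < f (q.1, 0) + q.2 * r := by
    have hlt := hf q hq
    rwa [hf_apply, hf_apply q.1, Prod.mk_zero_zero, map_zero, zero_add] at hlt
  calc P + -(r⁻¹ * f (q.1, 0)) = r⁻¹ * (P * r - f (q.1, 0)) := by field_simp; ring
    _ < r⁻¹ * (q.2 * r) := by gcongr; linarith
    _ = q.2 := by field_simp

theorem map_inr_nonpos_of_perturbations {L : StrongDual ℝ (E × (ι → ℝ))} {P : ℝ}
    (hL : ∀ p ∈ perturbations S φ, P + L p.1 < p.2) {s : E × ℝ} (hs : s ∈ S)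
    (hsφ : ∀ i, φ i s.1 < 0) {d : ι → ℝ} (hd : 0 ≤ d) : L (0, d) ≤ 0 := by
  by_contra! hpos
  obtain ⟨n, hn⟩ := exists_nat_gt ((s.2 + 1 - P) / L (0, d))
  rw [div_lt_iff₀ hpos] at hn
  have hmem : (((0, (n : ℝ) • d), s.2 + 1) : (E × (ι → ℝ)) × ℝ) ∈ perturbations S φ :=
    ⟨s, hs, fun i => by
      simpa using (hsφ i).trans_le (mul_nonneg n.cast_nonneg (hd i)), lt_add_one _⟩
  have hlt := hL _ hmem
  have hsmul : L (0, (n : ℝ) • d) = n * L (0, d) := by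
    rw [← smul_eq_mul, ← map_smul, Prod.smul_mk, smul_zero]
  linarith

theorem add_map_le_of_perturbations {L : StrongDual ℝ (E × (ι → ℝ))} {P : ℝ}
    (hL : ∀ p ∈ perturbations S φ, P + L p.1 < p.2) {s : E × ℝ} (hs : s ∈ S) (z : E) :
    P + L (z - s.1, fun i => φ i z) ≤ s.2 := by
  have hmem (ε : ℝ) (hε : 0 < ε) :
      (((z - s.1, fun i => φ i z + ε), s.2 + ε) : (E × (ι → ℝ)) × ℝ) ∈ perturbations S φ :=
    ⟨s, hs, fun i => by simpa using hε, by simpa using hε⟩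
  have hleft : Tendsto (fun ε : ℝ => P + L (z - s.1, fun i => φ i z + ε)) (𝓝[>] 0)
      (𝓝 (P + L (z - s.1, fun i => φ i z))) := by
    have hcont : Continuous fun ε : ℝ => P + L (z - s.1, fun i => φ i z + ε) := by fun_prop
    simpa using (hcont.tendsto 0).mono_left nhdsWithin_le_nhds
  have hright : Tendsto (fun ε : ℝ => s.2 + ε) (𝓝[>] 0) (𝓝 s.2) := by
    have hcont : Continuous fun ε : ℝ => s.2 + ε := by fun_prop
    simpa using (hcont.tendsto 0).mono_left nhdsWithin_le_nhds
  exact le_of_tendsto_of_tendsto hleft hright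
    (eventually_mem_nhdsWithin.mono fun ε hε => (hL _ (hmem ε hε)).le)

theorem exists_multipliers_of_convex_closure [IsTopologicalAddGroup E] [ContinuousSMul ℝ E]
    [Fintype ι] (hS : Convex ℝ (closure S)) (hφ : ∀ i, ConvexOn ℝ univ (φ i))
    (hφc : ∀ i, Continuous (φ i)) (hslater : ∃ s ∈ S, ∀ i, φ i s.1 < 0) {P : ℝ}
    (hP : ∀ s ∈ S, (∀ i, φ i s.1 < 0) → P ≤ s.2) :
    ∃ (l : StrongDual ℝ E) (m : ι → ℝ), (∀ i, 0 ≤ m i) ∧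
      ∀ s ∈ S, ∀ z, P ≤ s.2 - l s.1 + l z + ∑ i, m i * φ i z := by
  classical
  obtain ⟨s₀, hs₀, hs₀φ⟩ := hslater
  have hconvex : Convex ℝ (perturbations S φ) :=
    perturbations_closure hφc ▸ convex_perturbations hS hφ
  have hnotMem : (0, P) ∉ perturbations S φ := fun ⟨s, hs, hsφ, hsP⟩ =>
    (hP s hs fun i => by simpa using hsφ i).not_gt hsP
  have hmem : (0, s₀.2 + 1) ∈ perturbations S φ :=
    ⟨s₀, hs₀, fun i => by simpa using hs₀φ i, lt_add_one _⟩
  obtain ⟨L, hL⟩ := exists_strongDual_add_lt hconvex (isOpen_perturbations hφc) hnotMem hmem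
    ((hP s₀ hs₀ hs₀φ).trans_lt (lt_add_one _))
  refine ⟨-L.comp (.inl ℝ E (ι → ℝ)), fun i => -L (0, Pi.single i 1), fun i => ?_, fun s hs z => ?_⟩
  · exact neg_nonneg.2
      (map_inr_nonpos_of_perturbations hL hs₀ hs₀φ (Pi.single_nonneg.2 zero_le_one))
  have hsum : L (0, fun i => φ i z) = ∑ i, L (0, Pi.single i 1) * φ i z :=
    linearMap_pi_apply_eq_sum (L.comp (.inr ℝ E (ι → ℝ))).toLinearMap _
  have hsplit : L (z - s.1, fun i => φ i z) =
      L (z, 0) - L (s.1, 0) + L (0, fun i => φ i z) := by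
    rw [← map_sub, ← map_add]
    simp
  have hle := add_map_le_of_perturbations hL hs z
  simp only [neg_apply, ContinuousLinearMap.comp_apply, ContinuousLinearMap.inl_apply, neg_mul,
    Finset.sum_neg_distrib]
  linarith

end ConvexDuality

section Lyapunov

variable {Ω B E : Type*} [MeasurableSpace Ω] [NormedAddCommGroup B] [NormedAddCommGroup E]
  [NormedSpace ℝ E] {μ : Measure Ω} {θ : ℝ}

theorem continuous_measureReal_Iic (ν : Measure ℝ) [IsFiniteMeasure ν] [NullSingletonClass ν] :
    Continuous fun r => ν.real (Iic r) := by
  have hprimitive : (fun r => ν.real (Iic r)) =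
      fun r => ν.real (Iic 0) + ∫ _ in (0 : ℝ)..r, (1 : ℝ) ∂ν := by
    ext r
    rw [← intervalIntegral.integral_Iic_sub_Iic (integrable_const _).integrableOn
      (integrable_const _).integrableOn]
    simp
  rw [hprimitive]
  exact continuous_const.add
    (intervalIntegral.continuous_primitive (fun _ _ => intervalIntegrable_const) 0)

theorem tendsto_measureReal_Iic_atBot (ν : Measure ℝ) [IsFiniteMeasure ν] :
    Tendsto (fun r => ν.real (Iic r)) atBot (𝓝 0) := by
  have hinter := tendsto_measure_iInter_atBot (μ := ν) (fun _ : ℝ => nullMeasurableSet_Iic)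
    monotone_Iic ⟨0, measure_ne_top _ _⟩
  rw [iInter_Iic_eq_empty_iff.2 (by simp), measure_empty] at hinter
  exact (ENNReal.tendsto_toReal ENNReal.zero_ne_top).comp hinter

theorem Ioo_subset_range_measureReal_Iic (ν : Measure ℝ) [IsFiniteMeasure ν]
    [NullSingletonClass ν] : Ioo 0 (ν.real univ) ⊆ range fun r => ν.real (Iic r) := by
  rintro t ⟨ht₀, ht₁⟩
  have htop : Tendsto (fun r => ν.real (Iic r)) atTop (𝓝 (ν.real univ)) :=
    (ENNReal.tendsto_toReal (measure_ne_top _ _)).comp (tendsto_measure_Iic_atTop ν)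
  obtain ⟨a, ha⟩ := ((tendsto_measureReal_Iic_atBot ν).eventually_lt_const ht₀).exists
  obtain ⟨b, hb⟩ := (htop.eventually_const_lt ht₁).exists
  exact mem_range_of_exists_le_of_exists_ge (continuous_measureReal_Iic ν) ⟨a, ha.le⟩ ⟨b, hb.le⟩

theorem exists_measurableSet_subset_measureReal_eq [StandardBorelSpace Ω] [NullSingletonClass μ]
    {D : Set Ω} (hD : MeasurableSet D) (hμD : μ D ≠ ⊤) {t : ℝ} (ht : t ∈ Icc 0 (μ.real D)) :
    ∃ A ⊆ D, MeasurableSet A ∧ μ.real A = t := by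
  rcases ht.1.eq_or_lt with rfl | ht₀
  · exact ⟨∅, empty_subset D, MeasurableSet.empty, measureReal_empty⟩
  rcases ht.2.eq_or_lt with rfl | ht₁
  · exact ⟨D, subset_rfl, hD, rfl⟩
  have hT := measurableEmbedding_embeddingReal Ω
  have : IsFiniteMeasure (μ.restrict D) := isFiniteMeasure_restrict.2 hμD
  have : NullSingletonClass ((μ.restrict D).map (embeddingReal Ω)) := ⟨fun r => by
    rw [hT.map_apply]
    exact (subsingleton_singleton.preimage hT.injective).measure_zero _⟩
  obtain ⟨r, hr⟩ := Ioo_subset_range_measureReal_Iic ((μ.restrict D).map (embeddingReal Ω))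
    ⟨ht₀, by rwa [map_measureReal_apply hT.measurable .univ, preimage_univ,
      measureReal_restrict_apply_univ]⟩
  refine ⟨embeddingReal Ω ⁻¹' Iic r ∩ D, inter_subset_right,
    (hT.measurable measurableSet_Iic).inter hD, ?_⟩
  simpa only [map_measureReal_apply hT.measurable measurableSet_Iic,
    measureReal_restrict_apply (hT.measurable measurableSet_Iic)] using hr

theorem exists_setIntegral_simpleFunc_eq_smul [StandardBorelSpace Ω] [NullSingletonClass μ]
    [CompleteSpace E] (hθ : θ ∈ Icc 0 1) (g : SimpleFunc Ω E) (hg : Integrable g μ) :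
    ∃ A, MeasurableSet A ∧ ∫ v in A, g v ∂μ = θ • ∫ v, g v ∂μ := by
  have hfiber (e : E) : ∃ A ⊆ g ⁻¹' {e}, MeasurableSet A ∧
      μ.real A • e = θ • μ.real (g ⁻¹' {e}) • e := by
    rcases eq_or_ne e 0 with rfl | he
    · exact ⟨∅, empty_subset _, .empty, by simp only [smul_zero]⟩
    obtain ⟨A, hAsub, hA, hμA⟩ := exists_measurableSet_subset_measureReal_eq
      (g.measurableSet_fiber e) (g.measure_preimage_lt_top_of_integrable hg he).ne
      ⟨mul_nonneg hθ.1 measureReal_nonneg, mul_le_of_le_one_left measureReal_nonneg hθ.2⟩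
    exact ⟨A, hAsub, hA, by rw [hμA, mul_smul]⟩
  choose A hAsub hA hμA using hfiber
  have hdisj : (g.range : Set E).Pairwise (Function.onFun Disjoint A) := fun d _ e _ hde =>
    (Disjoint.preimage g (disjoint_singleton.2 hde)).mono (hAsub d) (hAsub e)
  refine ⟨⋃ e ∈ g.range, A e, g.range.measurableSet_biUnion fun e _ => hA e, ?_⟩
  rw [integral_biUnion_finset g.range (fun e _ => hA e) hdisj fun _ _ => hg.integrableOn,
    ← g.integral_eq_integral hg, SimpleFunc.integral_eq, Finset.smul_sum]
  refine Finset.sum_congr rfl fun e _ => ?_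
  rw [setIntegral_congr_fun (hA e) fun v hv => hAsub e hv, setIntegral_const, hμA]

theorem exists_norm_setIntegral_sub_smul_lt [StandardBorelSpace Ω] [NullSingletonClass μ]
    [CompleteSpace E] (hθ : θ ∈ Icc 0 1) {G : Ω → E} (hG : Integrable G μ) {ε : ℝ} (hε : 0 < ε) :
    ∃ A, MeasurableSet A ∧ ‖∫ v in A, G v ∂μ - θ • ∫ v, G v ∂μ‖ < ε := by
  obtain ⟨g, hGg, hg⟩ := (memLp_one_iff_integrable.2 hG).exists_simpleFunc_eLpNorm_sub_lt
    ENNReal.one_ne_top (ε := ENNReal.ofReal (ε / 2)) (by simpa using hε)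
  rw [memLp_one_iff_integrable] at hg
  have hR : Integrable (fun v => G v - g v) μ := hG.sub hg
  have hRnorm : ∫ v, ‖G v - g v‖ ∂μ < ε / 2 := by
    rw [eLpNorm_one_eq_lintegral_enorm] at hGg
    rw [integral_norm_eq_lintegral_enorm hR.1]
    exact ENNReal.toReal_lt_of_lt_ofReal hGg
  obtain ⟨A, hA, hAg⟩ := exists_setIntegral_simpleFunc_eq_smul hθ g hg
  have hRA : ‖∫ v in A, (G v - g v) ∂μ‖ ≤ ∫ v, ‖G v - g v‖ ∂μ :=
    (norm_integral_le_integral_norm _).trans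
      (setIntegral_le_integral hR.norm (ae_of_all _ fun _ => norm_nonneg _))
  have hRθ : ‖θ • ∫ v, (G v - g v) ∂μ‖ ≤ ∫ v, ‖G v - g v‖ ∂μ := by
    rw [norm_smul, Real.norm_of_nonneg hθ.1]
    exact (mul_le_of_le_one_left (norm_nonneg _) hθ.2).trans (norm_integral_le_integral_norm _)
  refine ⟨A, hA, ?_⟩
  calc ‖∫ v in A, G v ∂μ - θ • ∫ v, G v ∂μ‖
      = ‖∫ v in A, (G v - g v) ∂μ - θ • ∫ v, (G v - g v) ∂μ‖ := by
        rw [integral_sub hG.integrableOn hg.integrableOn, integral_sub hG hg, hAg, smul_sub,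
          sub_sub_sub_cancel_right]
    _ ≤ ‖∫ v in A, (G v - g v) ∂μ‖ + ‖θ • ∫ v, (G v - g v) ∂μ‖ := norm_sub_le _ _
    _ < ε := by linarith

theorem exists_norm_setIntegral_add_setIntegral_compl_sub_lt [StandardBorelSpace Ω]
    [NullSingletonClass μ] [CompleteSpace E] {a b : ℝ} (ha : 0 ≤ a) (hb : 0 ≤ b) (hab : a + b = 1)
    {G H : Ω → E} (hG : Integrable G μ) (hH : Integrable H μ) {ε : ℝ} (hε : 0 < ε) :
    ∃ A, MeasurableSet A ∧
      ‖∫ v in A, G v ∂μ + ∫ v in Aᶜ, H v ∂μ - (a • ∫ v, G v ∂μ + b • ∫ v, H v ∂μ)‖ < ε := by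
  obtain rfl : b = 1 - a := by linarith
  obtain ⟨A, hA, hlt⟩ :=
    exists_norm_setIntegral_sub_smul_lt ⟨ha, by linarith⟩ (hG.sub hH) hε
  refine ⟨A, hA, ?_⟩
  convert hlt using 2
  simp only [Pi.sub_apply]
  rw [integral_sub hG.integrableOn hH.integrableOn, integral_sub hG hH,
    ← integral_add_compl hA hH]
  module

theorem exists_Lp_ae_eq_of_mem_of_notMem {q : ENNReal} (α β : Lp B q μ) {A : Set Ω}
    (hA : MeasurableSet A) :
    ∃ δ : Lp B q μ, ∀ᵐ v ∂μ, (v ∈ A → δ v = α v) ∧ (v ∉ A → δ v = β v) := by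
  have hmem := ((Lp.memLp α).indicator hA).add ((Lp.memLp β).indicator hA.compl)
  refine ⟨hmem.toLp, ?_⟩
  filter_upwards [hmem.coeFn_toLp] with v hv
  exact ⟨fun h => by simp [hv, h], fun h => by simp [hv, h]⟩

theorem exists_Lp_integral_comp_eq_add {q : ENNReal} {F : B → Ω → E} {α β : Lp B q μ}
    (hα : Integrable (fun v => F (α v) v) μ) (hβ : Integrable (fun v => F (β v) v) μ)
    {A : Set Ω} (hA : MeasurableSet A) :
    ∃ δ : Lp B q μ, Integrable (fun v => F (δ v) v) μ ∧
      ∫ v, F (δ v) v ∂μ = ∫ v in A, F (α v) v ∂μ + ∫ v in Aᶜ, F (β v) v ∂μ := by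
  obtain ⟨δ, hδ⟩ := exists_Lp_ae_eq_of_mem_of_notMem α β hA
  have hF : (fun v => F (δ v) v) =ᵐ[μ]
      A.indicator (fun v => F (α v) v) + Aᶜ.indicator fun v => F (β v) v := by
    filter_upwards [hδ] with v hv
    by_cases h : v ∈ A
    · simp [hv.1 h, h]
    · simp [hv.2 h, h]
  have hαA := hα.indicator hA
  have hβA := hβ.indicator hA.compl
  refine ⟨δ, (hαA.add hβA).congr hF.symm, ?_⟩
  rw [integral_congr_ae hF, integral_add' hαA hβA, integral_indicator hA,
    integral_indicator hA.compl]

theorem convex_closure_setOf_integral_comp_Lp [StandardBorelSpace Ω] [NullSingletonClass μ]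
    [CompleteSpace E] (q : ENNReal) (F : B → Ω → E) :
    Convex ℝ (closure {e | ∃ α : Lp B q μ,
      Integrable (fun v => F (α v) v) μ ∧ ∫ v, F (α v) v ∂μ = e}) := by
  refine convex_closure_of_add_smul_mem_closure ?_
  rintro _ ⟨α, hα, rfl⟩ _ ⟨β, hβ, rfl⟩ a b ha hb hab
  rw [Metric.mem_closure_iff]
  intro ε hε
  obtain ⟨A, hA, hlt⟩ :=
    exists_norm_setIntegral_add_setIntegral_compl_sub_lt ha hb hab hα hβ hε
  obtain ⟨δ, hδ, hint⟩ := exists_Lp_integral_comp_eq_add hα hβ hA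
  exact ⟨_, ⟨δ, hδ, rfl⟩, by rwa [dist_comm, dist_eq_norm, hint]⟩

end Lyapunov

section SparseProgram

variable {p N : ℕ} {X : Set (EuclideanSpace ℝ (Fin p))} {W : Set ℝ}
  {k : EuclideanSpace ℝ (Fin p) → EuclideanSpace ℝ (Fin p) → ℝ → ℝ} {c : ℝ → ℝ → ℝ}
  {x : Fin N → EuclideanSpace ℝ (Fin p)} {y : Fin N → ℝ} {γ : ℝ}

/-- The integrand of the predictions at `x₁, …, x_N` and of the objective, as a function of the
value `a` of the coefficient function at `v = (z, w)`. -/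
noncomputable def integrand (k : EuclideanSpace ℝ (Fin p) → EuclideanSpace ℝ (Fin p) → ℝ → ℝ)
    (x : Fin N → EuclideanSpace ℝ (Fin p)) (γ a : ℝ) (v : Pt p) : (Fin N → ℝ) × ℝ :=
  (fun i => a * k (x i) v.1 v.2, 1 / 2 * a ^ 2 + γ * ({0}ᶜ : Set ℝ).indicator 1 a)

/-- The pairs of predictions and objective values attained by admissible coefficients. -/
def attainable (X : Set (EuclideanSpace ℝ (Fin p))) (W : Set ℝ)
    (k : EuclideanSpace ℝ (Fin p) → EuclideanSpace ℝ (Fin p) → ℝ → ℝ)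
    (x : Fin N → EuclideanSpace ℝ (Fin p)) (γ : ℝ) : Set ((Fin N → ℝ) × ℝ) :=
  (fun α : Coef X W => (fun i => predict k α (x i), objective γ α)) '' {α | Admissible k x α}

theorem measurableSet_coef_ne_zero (α : Coef X W) : MeasurableSet {v | α v ≠ 0} :=
  (Lp.stronglyMeasurable α).measurable (measurableSet_singleton 0).compl

theorem indicator_compl_zero_comp_coef (α : Coef X W) :
    (fun v => ({0}ᶜ : Set ℝ).indicator 1 (α v)) = {v | α v ≠ 0}.indicator (1 : Pt p → ℝ) := by
  ext v
  simp [indicator_apply]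

theorem norm_sq_eq_integral_sq (α : Coef X W) : ‖α‖ ^ 2 = ∫ v, α v ^ 2 ∂(leb X W) := by
  rw [← real_inner_self_eq_norm_sq, L2.inner_def]
  simp [sq]

theorem integrable_indicator_compl_zero_comp_coef [IsFiniteMeasure (leb X W)] (α : Coef X W) :
    Integrable (fun v => ({0}ᶜ : Set ℝ).indicator (1 : ℝ → ℝ) (α v)) (leb X W) := by
  rw [indicator_compl_zero_comp_coef]
  exact (integrable_const 1).indicator (measurableSet_coef_ne_zero α)

theorem integrable_integrand_snd [IsFiniteMeasure (leb X W)] (α : Coef X W) :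
    Integrable (fun v => (integrand k x γ (α v) v).2) (leb X W) :=
  ((Lp.memLp α).integrable_sq.const_mul _).add
    ((integrable_indicator_compl_zero_comp_coef α).const_mul _)

theorem integral_integrand_snd [IsFiniteMeasure (leb X W)] (α : Coef X W) :
    ∫ v, (integrand k x γ (α v) v).2 ∂(leb X W) = objective γ α := by
  simp only [integrand]
  rw [integral_add ((Lp.memLp α).integrable_sq.const_mul _)
      ((integrable_indicator_compl_zero_comp_coef α).const_mul _),
    integral_const_mul, integral_const_mul, ← norm_sq_eq_integral_sq,
    indicator_compl_zero_comp_coef, integral_indicator_one (measurableSet_coef_ne_zero α)]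
  rfl

theorem integrable_integrand_iff_admissible [IsFiniteMeasure (leb X W)] {α : Coef X W} :
    Integrable (fun v => integrand k x γ (α v) v) (leb X W) ↔ Admissible k x α :=
  ⟨fun h i => h.fst.eval i, fun h =>
    (Integrable.of_eval h).prodMk (integrable_integrand_snd (k := k) (x := x) α)⟩

theorem integral_integrand [IsFiniteMeasure (leb X W)] {α : Coef X W} (hα : Admissible k x α) :
    ∫ v, integrand k x γ (α v) v ∂(leb X W) = (fun i => predict k α (x i), objective γ α) := by
  refine (integral_pair (Integrable.of_eval hα)
    (integrable_integrand_snd (k := k) (x := x) α)).trans ?_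
  refine Prod.ext (funext fun i => ?_) (integral_integrand_snd (k := k) (x := x) α)
  exact eval_integral hα i

theorem attainable_eq_setOf_integral_integrand [IsFiniteMeasure (leb X W)] :
    attainable X W k x γ = {e | ∃ α : Coef X W,
      Integrable (fun v => integrand k x γ (α v) v) (leb X W) ∧
        ∫ v, integrand k x γ (α v) v ∂(leb X W) = e} := by
  ext s
  refine exists_congr fun α => ?_
  rw [integrable_integrand_iff_admissible]
  exact and_congr_right fun hα => by rw [integral_integrand hα]

theorem convex_closure_attainable [IsFiniteMeasure (leb X W)] :
    Convex ℝ (closure (attainable X W k x γ)) := by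
  have : NullSingletonClass (volume : Measure (Pt p)) := by
    rw [Measure.volume_eq_prod]
    infer_instance
  rw [attainable_eq_setOf_integral_integrand]
  exact convex_closure_setOf_integral_comp_Lp 2 (integrand k x γ)

theorem neg_abs_mul_le_objective [IsFiniteMeasure (leb X W)] (α : Coef X W) :
    -|γ| * (leb X W).real univ ≤ objective γ α := by
  have hl0 : l0 α ≤ (leb X W).real univ := measureReal_mono (subset_univ _)
  calc -|γ| * (leb X W).real univ ≤ -|γ| * l0 α :=
        mul_le_mul_of_nonpos_left hl0 (neg_nonpos.2 (abs_nonneg γ))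
    _ ≤ γ * l0 α := mul_le_mul_of_nonneg_right (neg_abs_le γ) measureReal_nonneg
    _ ≤ objective γ α := le_add_of_nonneg_left (by positivity)

theorem primalValue_le_of_feasible {α : Coef X W} {yhat : Fin N → ℝ}
    (h : Feasible k c x y α yhat) : primalValue X W k c x y γ ≤ objective γ α :=
  iInf_le_of_le α (iInf_le_of_le yhat (iInf_le _ h))

theorem exists_primalValue_eq_coe [IsFiniteMeasure (leb X W)] (hS : Slater X W k c x y) :
    ∃ P : ℝ, primalValue X W k c x y γ = P := by
  obtain ⟨α, yhat, hα, hyhat, hlt⟩ := hS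
  have hle : primalValue X W k c x y γ ≤ (objective γ α : EReal) :=
    primalValue_le_of_feasible ⟨hα, hyhat, fun i => (hlt i).le⟩
  have hge : ((-|γ| * (leb X W).real univ : ℝ) : EReal) ≤ primalValue X W k c x y γ :=
    le_iInf fun β => le_iInf fun _ => le_iInf fun _ =>
      EReal.coe_le_coe_iff.2 (neg_abs_mul_le_objective β)
  exact ⟨_, (EReal.coe_toReal (ne_top_of_le_ne_top (EReal.coe_ne_top _) hle)
    (ne_bot_of_le_ne_bot (EReal.coe_ne_bot _) hge)).symm⟩

theorem lagrangian_le_objective_of_feasible {α : Coef X W} {yhat lam mu : Fin N → ℝ}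
    (hmu : ∀ i, 0 ≤ mu i) (h : Feasible k c x y α yhat) :
    lagrangian k c x y γ α yhat lam mu ≤ objective γ α := by
  obtain ⟨-, hyhat, hle⟩ := h
  have hpenalty : ∑ i, mu i * c (yhat i) (y i) ≤ 0 :=
    Finset.sum_nonpos fun i _ => mul_nonpos_of_nonneg_of_nonpos (hmu i) (hle i)
  simp only [lagrangian, ← hyhat]
  linarith

theorem dualValue_le_primalValue : dualValue X W k c x y γ ≤ primalValue X W k c x y γ :=
  iSup_le fun _ => iSup_le fun _ => iSup_le fun hmu =>
    le_iInf fun α => le_iInf fun yhat => le_iInf fun h =>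
      (iInf_le_of_le α (iInf_le_of_le h.1 (iInf_le _ yhat))).trans
        (EReal.coe_le_coe_iff.2 (lagrangian_le_objective_of_feasible hmu h))

theorem exists_le_dualFunction_of_le_primalValue [IsFiniteMeasure (leb X W)]
    (hc : ∀ i, ConvexOn ℝ univ (fun t : ℝ => c t (y i))) (hS : Slater X W k c x y) {P : ℝ}
    (hP : (P : EReal) ≤ primalValue X W k c x y γ) :
    ∃ lam mu : Fin N → ℝ, (∀ i, 0 ≤ mu i) ∧ (P : EReal) ≤ dualFunction X W k c x y γ lam mu := by
  obtain ⟨α₀, yhat₀, hα₀, hyhat₀, hlt⟩ := hS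
  have hslater : ∃ s ∈ attainable X W k x γ, ∀ i, c (s.1 i) (y i) < 0 :=
    ⟨_, mem_image_of_mem _ hα₀, fun i => by simpa only [← hyhat₀ i] using hlt i⟩
  have hbound : ∀ s ∈ attainable X W k x γ, (∀ i, c (s.1 i) (y i) < 0) → P ≤ s.2 := by
    rintro _ ⟨α, hα, rfl⟩ hneg
    exact EReal.coe_le_coe_iff.1
      (hP.trans (primalValue_le_of_feasible ⟨hα, fun _ => rfl, fun i => (hneg i).le⟩))
  have hcont (i : Fin N) : Continuous fun t => c t (y i) :=
    continuousOn_univ.1 ((hc i).continuousOn isOpen_univ)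
  obtain ⟨l, m, hm, hle⟩ := exists_multipliers_of_convex_closure
    (φ := fun i (yhat : Fin N → ℝ) => c (yhat i) (y i)) convex_closure_attainable
    (fun i => (hc i).comp_linearMap (LinearMap.proj (φ := fun _ => ℝ) i))
    (fun i => (hcont i).comp (continuous_apply i)) hslater hbound
  refine ⟨fun i => l (Pi.single i 1), m, hm, le_iInf fun α => le_iInf fun hα => le_iInf fun yhat =>
    EReal.coe_le_coe_iff.2 ?_⟩
  have hl (v : Fin N → ℝ) : ∑ i, l (Pi.single i 1) * v i = l v :=
    (linearMap_pi_apply_eq_sum l.toLinearMap v).symm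
  unfold lagrangian
  rw [hl, hl]
  exact hle _ (mem_image_of_mem _ hα) yhat

end SparseProgram

end SFP

theorem theorem1_general {p N : ℕ}
    (X : Set (EuclideanSpace ℝ (Fin p))) (W : Set ℝ)
    (hXW : volume (X ×ˢ W) ≠ ⊤)
    (k : EuclideanSpace ℝ (Fin p) → EuclideanSpace ℝ (Fin p) → ℝ → ℝ)
    (c : ℝ → ℝ → ℝ)
    (x : Fin N → EuclideanSpace ℝ (Fin p)) (y : Fin N → ℝ) (γ : ℝ)
    (hc : ∀ i, ConvexOn ℝ Set.univ (fun t : ℝ => c t (y i)))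
    (hS : SFP.Slater X W k c x y) :
    ∃ (P : ℝ) (lam mu : Fin N → ℝ), (∀ i, 0 ≤ mu i) ∧
      SFP.primalValue X W k c x y γ = (P : EReal) ∧
      SFP.dualValue X W k c x y γ = (P : EReal) ∧
      SFP.dualFunction X W k c x y γ lam mu = (P : EReal) := by
  have : IsFiniteMeasure (SFP.leb X W) := isFiniteMeasure_restrict.2 hXW
  obtain ⟨P, hP⟩ := SFP.exists_primalValue_eq_coe (γ := γ) hS
  obtain ⟨lam, mu, hmu, hle⟩ := SFP.exists_le_dualFunction_of_le_primalValue hc hS hP.ge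
  have hdual : SFP.dualFunction X W k c x y γ lam mu ≤ SFP.dualValue X W k c x y γ :=
    le_iSup_of_le lam (le_iSup_of_le mu (le_iSup_of_le hmu le_rfl))
  have hweak : SFP.dualValue X W k c x y γ ≤ P := SFP.dualValue_le_primalValue.trans hP.le
  exact ⟨P, lam, mu, hmu, hP, hweak.antisymm (hle.trans hdual), (hdual.trans hweak).antisymm hle⟩

theorem theorem1 {p N : ℕ}
    (X : Set (EuclideanSpace ℝ (Fin p))) (hX : IsCompact X)
    (W : Set ℝ) (hW : IsCompact W)
    (k : EuclideanSpace ℝ (Fin p) → EuclideanSpace ℝ (Fin p) → ℝ → ℝ)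
    (c : ℝ → ℝ → ℝ)
    (x : Fin N → EuclideanSpace ℝ (Fin p)) (hx : ∀ i, x i ∈ X)
    (y : Fin N → ℝ) (γ : ℝ) (hγ : 0 ≤ γ)
    -- the loss is convex in the prediction
    (hc : ∀ i, ConvexOn ℝ Set.univ (fun t : ℝ => c t (y i)))
    -- the kernel sections are genuine measurable functions (densities with respect to `dz dw`)
    (hk : ∀ i, AEStronglyMeasurable (fun v : SFP.Pt p => k (x i) v.1 v.2) (SFP.leb X W))
    (hS : SFP.Slater X W k c x y) :
    ∃ P D : ℝ, SFP.primalValue X W k c x y γ = (P : EReal) ∧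
      SFP.dualValue X W k c x y γ = (D : EReal) ∧ P - D = 0 := by
  obtain ⟨P, _, _, _, hP, hD, _⟩ :=
    theorem1_general X W (hX.prod hW).measure_ne_top k c x y γ hc hS
  exact ⟨P, P, hP, hD, sub_self P⟩
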